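/- Let $A$ be a nontrivial finite abelian group with $A\cong A_1\oplus A_2$, where $A_1$ has odd order and $A_2\cong (\mathbb{Z}/2\mathbb{Z})^{a_1}\oplus(\mathbb{Z}/2^2\mathbb{Z})^{a_2}\oplus\cdots\oplus(\mathbb{Z}/2^t\mathbb{Z})^{a_t}$ with $t\ge 0$, $a_i\ge 0$ and $a_i\neq 1$ for all $1\le i\le t$. Then there is a bireversible automaton with exactly $|A|$ states over an alphabet with exactly $|A|$ letters whose automaton group is isomorphic to the lamplighter group $A\wr\mathbb{Z}$. Here an automaton $(Q,X,\delta,\lambda)$ consists of a finite set of states $Q$, a finite alphabet $X$, a transition function $\delta\colon Q\times X\to Q$ and an output function $\lambda\colon Q\times X\to X$. Each state $q$ acts on finite words over $X$ by $\lambda_q(\varnothing)=\varnothing$ and $\lambda_q(xw)=\lambda(q,x)\,\lambda_{\delta(q,x)}(w)$. The automaton is invertible if $x\mapsto\lambda(q,x)$ is a permutation of $X$ for every $q\in Q$; its inverse is then obtained by exchanging the input letter $x$ and the output letter $\lambda(q,x)$ on each edge $q\to\delta(q,x)$. The dual automaton is $(X,Q,\lambda,\delta)$, with the roles of states and letters exchanged.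 An invertible automaton is reversible if its dual is invertible, and bireversible if both it and its inverse are reversible. The automaton group of an invertible automaton is the group of permutations of the set of finite words over $X$ generated, under composition, by the maps $\lambda_q$, $q\in Q$. Finally, $A\wr\mathbb{Z}=\bigl(\bigoplus_{\mathbb{Z}}A\bigr)\rtimes\mathbb{Z}$ is the restricted wreath product, with $\mathbb{Z}$ acting by shifts. -/

import Mathlib

universe u v w

/-- A (Mealy) automaton with state set `Q` over the alphabet `X`. It is finite when `Q` and `X` are;
this is required separately where automata are used. -/
structure MealyAutomaton (Q : Type u) (X : Type v) where
  /-- the transition function -/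
  trans : Q → X → Q
  /-- the output function -/
  out : Q → X → X

namespace MealyAutomaton

variable {Q : Type u} {X : Type v}

/-- The extension of the state function of `q` to finite words, the first letter of a list being
the first letter read. -/
def stateFun (M : MealyAutomaton Q X) : Q → List X → List X
  | _, [] => []
  | q, x :: w => M.out q x :: M.stateFun (M.trans q x) w

/-- Every state function permutes the alphabet. -/
def IsInvertible (M : MealyAutomaton Q X) : Prop :=
  ∀ q : Q, Function.Bijective (M.out q)

/-- States and letters are interchanged, and so are the transition and output functions. -/
def dual (M : MealyAutomaton Q X) : MealyAutomaton X Q where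
  trans x q := M.out q x
  out x q := M.trans q x

/-- The inverse automaton: each edge `q --x|y--> q'` is replaced by `q --y|x--> q'`. -/
noncomputable def inverse (M : MealyAutomaton Q X) (h : M.IsInvertible) : MealyAutomaton Q X where
  trans q y := M.trans q ((Equiv.ofBijective (M.out q) (h q)).symm y)
  out q y := (Equiv.ofBijective (M.out q) (h q)).symm y

/-- An invertible automaton whose dual is invertible. -/
def IsReversible (M : MealyAutomaton Q X) : Prop :=
  M.IsInvertible ∧ M.dual.IsInvertible

/-- A reversible automaton whose inverse is reversible. -/
structure IsBireversible (M : MealyAutomaton Q X) : Prop where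
  invertible : M.IsInvertible
  reversible : M.IsReversible
  inverse_reversible : (M.inverse invertible).IsReversible

theorem inverse_stateFun_stateFun (M : MealyAutomaton Q X) (h : M.IsInvertible) (q : Q)
    (w : List X) : (M.inverse h).stateFun q (M.stateFun q w) = w := by
  induction w generalizing q with
  | nil => rfl
  | cons x w ih =>
    have hx : (Equiv.ofBijective (M.out q) (h q)).symm (M.out q x) = x :=
      (Equiv.ofBijective (M.out q) (h q)).symm_apply_apply x
    simp only [stateFun, inverse, hx]
    exact congrArg _ (ih _)

theorem stateFun_inverse_stateFun (M : MealyAutomaton Q X) (h : M.IsInvertible) (q : Q)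
    (w : List X) : M.stateFun q ((M.inverse h).stateFun q w) = w := by
  induction w generalizing q with
  | nil => rfl
  | cons y w ih =>
    have hy : M.out q ((Equiv.ofBijective (M.out q) (h q)).symm y) = y :=
      (Equiv.ofBijective (M.out q) (h q)).apply_symm_apply y
    simp only [stateFun, inverse, hy]
    exact congrArg _ (ih _)

/-- The state function of `q` as a permutation of the set of finite words. -/
noncomputable def statePerm (M : MealyAutomaton Q X) (h : M.IsInvertible) (q : Q) :
    Equiv.Perm (List X) where
  toFun := M.stateFun q
  invFun := (M.inverse h).stateFun q
  left_inv := M.inverse_stateFun_stateFun h q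
  right_inv := M.stateFun_inverse_stateFun h q

/-- The automaton group: the group generated, under composition, by the state functions. -/
def automatonGroup (M : MealyAutomaton Q X) (h : M.IsInvertible) :
    Subgroup (Equiv.Perm (List X)) :=
  Subgroup.closure (Set.range (M.statePerm h))

end MealyAutomaton

/-- The action of `ℤ` on `⨁_ℤ A` by shifts: `n` sends `f` to `m ↦ f (m - n)`. -/
noncomputable def shiftHom (A : Type w) [AddCommGroup A] :
    Multiplicative ℤ →* MulAut (Multiplicative (ℤ →₀ A)) where
  toFun n := AddEquiv.toMultiplicative (Finsupp.domCongr (Equiv.addLeft n.toAdd))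
  map_one' := by
    refine MulEquiv.ext fun f => Multiplicative.toAdd.injective (Finsupp.ext fun m => ?_)
    change f.toAdd (-(0 : ℤ) + m) = f.toAdd m
    simp
  map_mul' a b := by
    refine MulEquiv.ext fun f => Multiplicative.toAdd.injective (Finsupp.ext fun m => ?_)
    change f.toAdd (-(a.toAdd + b.toAdd) + m) = f.toAdd (-b.toAdd + (-a.toAdd + m))
    congr 1
    ring

/-- The lamplighter group: the restricted wreath product `A ≀ ℤ = (⨁_ℤ A) ⋊ ℤ`, written
multiplicatively. -/
abbrev Lamplighter (A : Type w) [AddCommGroup A] : Type w :=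
  Multiplicative (ℤ →₀ A) ⋊[shiftHom A] Multiplicative ℤ

/-!
Suppose `e` is an endomorphism of the finite abelian group `A` such that `e` and `e - 1` are both
bijective. Take `A` as state set and as alphabet, with output `q + x` and transition `e q + x`.
The map `e q + x` is bijective in `q` because `e` is, and the inverse automaton has transition
`(e - 1) q + y`, bijective in `q` because `e - 1` is; so the automaton is bireversible.

Identify sequences in `A` with formal power series `A⟦t⟧`. Solving the recursion shows that the
state `q` acts by `v ↦ α v + q β`, where `β = 1 / (1 - e t)` and `α = 1 + τ` with
`τ = t / (1 - e t)`. The automaton group is therefore generated by multiplication by `α` and by the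
translations by `q β`, and `(g, n) ↦ (v ↦ α ^ n v + ∑ i, α ^ i (g i) β)` maps `A ≀ ℤ` onto it. This
map is injective as soon as the series `α ^ i (g i) β` are independent. Multiplying by a power of
`α` leaves only exponents `i ≥ 0`, and then one expands in powers of `τ = α - 1`: as `τ ^ j` raises
the order by exactly `j` and keeps the leading coefficient, the coefficients with respect to
`τ ^ j β` are unique (`seq_eq_zero_of_sum_tau_pow`), and the change from powers of `τ` to powers
of `α` is unitriangular (`eq_zero_of_sum_alpha_pow`).

Such an `e` is an injective endomorphism without nonzero fixed points. On a group of odd order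
doubling is one; on `B ^ (m + 2)`, for every abelian group `B`, the companion map of
`X ^ (m + 2) - X - 1` is one, since this polynomial takes the value `-1` at `0` and at `1`. The
condition `a i ≠ 1` makes this applicable to every factor of the 2-part.
-/

/-! ### Fixed-point-free endomorphisms -/

/-- `A` has an injective endomorphism fixing only `0`. When `A` is finite this says that there is
an automorphism `e` for which `e - 1` is an automorphism as well. -/
def HasFixedPointFreeEnd (A : Type*) [AddCommGroup A] : Prop :=
  ∃ e : A →+ A, (∀ x, e x = 0 → x = 0) ∧ ∀ x, e x = x → x = 0

namespace HasFixedPointFreeEnd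

variable {A B : Type*} [AddCommGroup A] [AddCommGroup B]

theorem of_addEquiv (f : A ≃+ B) (h : HasFixedPointFreeEnd B) : HasFixedPointFreeEnd A := by
  obtain ⟨e, h0, h1⟩ := h
  refine ⟨f.symm.toAddMonoidHom.comp (e.comp f.toAddMonoidHom), fun x hx => ?_, fun x hx => ?_⟩
  · have : e (f x) = 0 := by simpa using hx
    simpa using h0 _ this
  · have : e (f x) = f x := by simpa using congrArg f hx
    simpa using h1 _ this

theorem prod (hA : HasFixedPointFreeEnd A) (hB : HasFixedPointFreeEnd B) :
    HasFixedPointFreeEnd (A × B) := by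
  obtain ⟨e, h0, h1⟩ := hA
  obtain ⟨f, k0, k1⟩ := hB
  refine ⟨e.prodMap f, fun x hx => ?_, fun x hx => ?_⟩
  · exact Prod.ext (h0 _ (congrArg Prod.fst hx)) (k0 _ (congrArg Prod.snd hx))
  · exact Prod.ext (h1 _ (congrArg Prod.fst hx)) (k1 _ (congrArg Prod.snd hx))

theorem pi {ι : Type*} {B : ι → Type*} [∀ i, AddCommGroup (B i)]
    (h : ∀ i, HasFixedPointFreeEnd (B i)) : HasFixedPointFreeEnd (∀ i, B i) := by
  choose e h0 h1 using h
  refine ⟨AddMonoidHom.mk' (fun x i => e i (x i)) fun x y => funext fun i => by simp,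
    fun x hx => funext fun i => h0 i _ (congrFun hx i),
    fun x hx => funext fun i => h1 i _ (congrFun hx i)⟩

/-- Doubling works. -/
theorem of_odd_card (h : Odd (Nat.card A)) : HasFixedPointFreeEnd A := by
  refine ⟨AddMonoidHom.mk' (fun x => x + x) fun x y => by abel, fun x hx => ?_, fun x hx => ?_⟩
  · have h2 : 2 • x = 0 := by rw [two_nsmul]; exact hx
    have hc : (Nat.card A).Coprime 2 := h.coprime_two_right
    exact (hc.nsmul_right_bijective (G := A)).1 (by simpa using h2)
  · exact add_eq_right.1 hx

/-- The companion map `(x₀, …, xₙ) ↦ (x₁, …, xₙ, x₀ + x₁)` works: a fixed vector is constant,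
with value `c` satisfying `c = c + c`. -/
theorem fin_add_two (m : ℕ) : HasFixedPointFreeEnd (Fin (m + 2) → B) := by
  let e : (Fin (m + 2) → B) →+ (Fin (m + 2) → B) := AddMonoidHom.mk'
    (fun x => Fin.snoc (α := fun _ => B) (fun i : Fin (m + 1) => x i.succ) (x 0 + x 1)) <| by
      intro x y
      funext i
      refine Fin.lastCases ?_ (fun i => ?_) i
      · simp only [Fin.snoc_last, Pi.add_apply]; abel
      · simp only [Fin.snoc_castSucc, Pi.add_apply]
  have hs (x) (i : Fin (m + 1)) : e x i.castSucc = x i.succ := by simp [e]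
  have hl (x) : e x (Fin.last _) = x 0 + x 1 := by simp [e]
  refine ⟨e, fun x hx => ?_, fun x hx => ?_⟩
  · have h1 (i : Fin (m + 1)) : x i.succ = 0 := by rw [← hs x, hx]; rfl
    have h0 : x 0 = 0 := by
      have h := hl x
      have h1' : x 1 = 0 := h1 0
      rw [hx, h1', add_zero] at h
      exact h.symm
    exact funext fun i => Fin.cases h0 h1 i
  · have hc (i : Fin (m + 2)) : x i = x 0 := by
      induction i using Fin.induction with
      | zero => rfl
      | succ i ih => rw [← hs x, hx, ih]
    have h0 : x 0 = 0 := by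
      have h := hl x
      rw [hx, hc, hc 1] at h
      exact left_eq_add.1 h
    exact funext fun i => (hc i).trans h0

theorem fin_of_ne_one {n : ℕ} (hn : n ≠ 1) : HasFixedPointFreeEnd (Fin n → B) := by
  match n, hn with
  | 0, _ => exact ⟨0, fun x _ => Subsingleton.elim _ _, fun x _ => Subsingleton.elim _ _⟩
  | m + 2, _ => exact fin_add_two m

end HasFixedPointFreeEnd

namespace AffineAutomaton

variable {A : Type*} [AddCommGroup A]

/-! ### The automaton and its bireversibility -/

/-- The automaton on the states and letters `A` with output `q + x` and transition `e q + x`. -/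
def automaton (e : A →+ A) : MealyAutomaton A A where
  trans q x := e q + x
  out q x := q + x

theorem isInvertible (e : A →+ A) : (automaton e).IsInvertible := fun q =>
  (Equiv.addLeft q).bijective

theorem inverse_out (e : A →+ A) (q y : A) :
    ((automaton e).inverse (isInvertible e)).out q y = y - q := by
  change (Equiv.ofBijective _ (isInvertible e q)).symm y = y - q
  rw [Equiv.symm_apply_eq]
  change y = q + (y - q)
  abel

theorem inverse_trans (e : A →+ A) (q y : A) :
    ((automaton e).inverse (isInvertible e)).trans q y = e q - q + y := by
  change e q + ((automaton e).inverse (isInvertible e)).out q y = _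
  rw [inverse_out]
  abel

theorem isBireversible [Finite A] {e : A →+ A} (h0 : ∀ x, e x = 0 → x = 0)
    (h1 : ∀ x, e x = x → x = 0) : (automaton e).IsBireversible where
  invertible := isInvertible e
  reversible := by
    refine ⟨isInvertible e, fun x => Finite.injective_iff_bijective.1 fun q q' h => ?_⟩
    exact (injective_iff_map_eq_zero e).2 h0 (add_right_cancel h)
  inverse_reversible := by
    refine ⟨fun q => ?_, fun y => Finite.injective_iff_bijective.1 fun q q' h => ?_⟩
    · rw [show ((automaton e).inverse (isInvertible e)).out q = Equiv.subRight q from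
        funext fun y => inverse_out e q y]
      exact (Equiv.subRight q).bijective
    · have h : e q - q + y = e q' - q' + y := by
        rw [← inverse_trans, ← inverse_trans]; exact h
      refine sub_eq_zero.1 (h1 _ ?_)
      rw [map_sub]
      exact sub_eq_sub_iff_sub_eq_sub.1 (add_right_cancel h)

/-! ### The action on sequences -/

/-- The state reached from `q` after the first `n` letters of the sequence `v`. -/
def stateSeq (e : A →+ A) (q : A) (v : ℕ → A) : ℕ → A
  | 0 => q
  | n + 1 => e (stateSeq e q v n) + v n

theorem stateSeq_add (e : A →+ A) (q q' : A) (v w : ℕ → A) :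
    stateSeq e (q + q') (v + w) = stateSeq e q v + stateSeq e q' w := by
  funext n
  induction n with
  | zero => rfl
  | succ n ih =>
    simp only [stateSeq, ih, Pi.add_apply, map_add]
    abel

theorem stateSeq_succ (e : A →+ A) (q : A) (v : ℕ → A) (n : ℕ) :
    stateSeq e q v (n + 1) = stateSeq e (e q + v 0) (fun k => v (k + 1)) n := by
  induction n with
  | zero => rfl
  | succ n ih => rw [stateSeq, ih]; rfl

/-- Multiplication by `t / (1 - e t)`: the states passed when reading a sequence from state `0`. -/
def tau (e : A →+ A) : AddMonoid.End (ℕ → A) :=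
  AddMonoidHom.mk' (stateSeq e 0) fun v w => by
    rw [← stateSeq_add, add_zero]

/-- Multiplication of the constant series `q` by `1 / (1 - e t)`: the states passed when reading
zeros from state `q`. -/
def beta (e : A →+ A) : A →+ (ℕ → A) :=
  AddMonoidHom.mk' (fun q => stateSeq e q 0) fun q q' => by
    rw [← stateSeq_add, add_zero]

theorem tau_apply_succ (e : A →+ A) (v : ℕ → A) (n : ℕ) :
    tau e v (n + 1) = e (tau e v n) + v n := rfl

/-- Multiplication by `α = 1 + t / (1 - e t)`, a unit with inverse `1 - t / (1 - (e - 1) t)`. -/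
def alpha (e : A →+ A) : (AddMonoid.End (ℕ → A))ˣ where
  val := 1 + tau e
  inv := 1 - tau (e - AddMonoidHom.id A)
  val_inv := by
    have h (v : ℕ → A) :
        tau e (v - tau (e - AddMonoidHom.id A) v) = tau (e - AddMonoidHom.id A) v := by
      funext n
      induction n with
      | zero => rfl
      | succ n ih =>
        rw [tau_apply_succ, tau_apply_succ, ih, Pi.sub_apply, AddMonoidHom.sub_apply,
          AddMonoidHom.id_apply]
        abel
    refine AddMonoidHom.ext fun v => ?_
    change (v - tau (e - AddMonoidHom.id A) v) + tau e (v - tau (e - AddMonoidHom.id A) v) = v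
    rw [h]
    abel
  inv_val := by
    have h (v : ℕ → A) : tau (e - AddMonoidHom.id A) (v + tau e v) = tau e v := by
      funext n
      induction n with
      | zero => rfl
      | succ n ih =>
        rw [tau_apply_succ, tau_apply_succ, ih, Pi.add_apply, AddMonoidHom.sub_apply,
          AddMonoidHom.id_apply]
        abel
    refine AddMonoidHom.ext fun v => ?_
    change (v + tau e v) - tau (e - AddMonoidHom.id A) (v + tau e v) = v
    rw [h]
    abel

/-! ### Independence of the translations -/

theorem tau_pow_apply_of_lt (e : A →+ A) (v : ℕ → A) {j n : ℕ} (h : n < j) :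
    (tau e ^ j) v n = 0 := by
  induction j generalizing n with
  | zero => omega
  | succ j ih =>
    rw [pow_succ', AddMonoid.End.coe_mul, Function.comp_apply]
    -- `τ` has zero constant coefficient and each later one only uses earlier input coefficients
    induction n with
    | zero => rfl
    | succ n ihn => rw [tau_apply_succ, ihn (by omega), ih (by omega), map_zero, add_zero]

theorem tau_pow_apply_self (e : A →+ A) (v : ℕ → A) (j : ℕ) : (tau e ^ j) v j = v 0 := by
  induction j with
  | zero => rfl
  | succ j ih =>
    have h : tau e ((tau e ^ j) v) j = 0 := by
      have := tau_pow_apply_of_lt e v (Nat.lt_succ_self j)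
      rwa [pow_succ', AddMonoid.End.coe_mul, Function.comp_apply] at this
    rw [pow_succ', AddMonoid.End.coe_mul, Function.comp_apply, tau_apply_succ,
      h, ih, map_zero, zero_add]

theorem seq_eq_zero_of_sum_tau_pow (e : A →+ A) (N : ℕ) (h : ℕ → A)
    (hs : ∑ j ∈ Finset.range N, (tau e ^ j) (beta e (h j)) = 0) : ∀ j < N, h j = 0 := by
  intro j
  induction j using Nat.strong_induction_on with
  | _ j ih =>
    intro hj
    have hc := congrFun hs j
    rw [Finset.sum_apply, Finset.sum_eq_single j, tau_pow_apply_self] at hc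
    · exact hc
    · intro i hi hij
      rcases lt_or_gt_of_ne hij with hlt | hgt
      · rw [ih i hlt (hlt.trans hj), map_zero, map_zero]; rfl
      · exact tau_pow_apply_of_lt e _ hgt
    · exact fun hn => absurd (Finset.mem_range.2 hj) hn

theorem alpha_pow_apply (e : A →+ A) {i N : ℕ} (h : i < N) (v : ℕ → A) :
    ((alpha e : AddMonoid.End (ℕ → A)) ^ i) v
      = ∑ j ∈ Finset.range N, (tau e ^ j) (i.choose j • v) := by
  have h1 : (alpha e : AddMonoid.End (ℕ → A)) = tau e + 1 := add_comm _ _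
  have h2 : (tau e + 1) ^ i = ∑ j ∈ Finset.range (i + 1), i.choose j • tau e ^ j := by
    rw [(Commute.one_right (tau e)).add_pow]
    exact Finset.sum_congr rfl fun j _ => by rw [one_pow, mul_one, nsmul_eq_mul, Nat.cast_comm]
  rw [h1, h2]
  have h3 : (∑ j ∈ Finset.range (i + 1), i.choose j • tau e ^ j) v
      = ∑ j ∈ Finset.range (i + 1), (i.choose j • tau e ^ j) v :=
    AddMonoidHom.finsetSum_apply _ _ _
  rw [h3, ← Finset.sum_subset (Finset.range_mono (show i + 1 ≤ N from h))]
  · exact Finset.sum_congr rfl fun j _ => (map_nsmul _ _ _).symm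
  · intro j _ hj
    rw [Nat.choose_eq_zero_of_lt (by simpa using hj), zero_smul, map_zero]

/-- The coefficient of `τ ^ j` in `∑ i < N, α ^ i (g i) β` is `∑ i < N, (i.choose j) • g i`; these
all vanish, and the last index with `g i ≠ 0` would contribute `g i` itself. -/
theorem eq_zero_of_sum_alpha_pow (e : A →+ A) (N : ℕ) (g : ℕ → A)
    (hs : ∑ i ∈ Finset.range N, ((alpha e : AddMonoid.End (ℕ → A)) ^ i) (beta e (g i)) = 0) :
    ∀ i < N, g i = 0 := by
  have hcoef := seq_eq_zero_of_sum_tau_pow e N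
    (fun j => ∑ i ∈ Finset.range N, i.choose j • g i) <| by
      rw [← hs, Finset.sum_congr rfl fun i hi =>
        alpha_pow_apply e (Finset.mem_range.1 hi) (beta e (g i)), Finset.sum_comm]
      refine Finset.sum_congr rfl fun j _ => ?_
      rw [map_sum, map_sum]
      exact Finset.sum_congr rfl fun i _ => by rw [map_nsmul (beta e)]
  -- downward induction on `i`
  have key : ∀ k i, i < N → N ≤ i + k → g i = 0 := by
    intro k
    induction k with
    | zero => omega
    | succ k ih =>
      intro i hi hik
      have hc := hcoef i hi
      rw [Finset.sum_eq_single i, Nat.choose_self, one_smul] at hc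
      · exact hc
      · intro l hl hli
        rcases lt_or_gt_of_ne hli with hlt | hgt
        · rw [Nat.choose_eq_zero_of_lt hlt, zero_smul]
        · rw [ih l (Finset.mem_range.1 hl) (by omega), smul_zero]
      · exact fun hn => absurd (Finset.mem_range.2 hi) hn
  exact fun i hi => key N i hi (by omega)

/-- The map `g ↦ ∑ i, α ^ i (g i) β` from lamp configurations to series. -/
noncomputable def theta (e : A →+ A) : (ℤ →₀ A) →+ (ℕ → A) :=
  Finsupp.liftAddHom fun i : ℤ =>
    ((alpha e ^ i : (AddMonoid.End (ℕ → A))ˣ) : AddMonoid.End (ℕ → A)).comp (beta e)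

theorem theta_single (e : A →+ A) (i : ℤ) (q : A) :
    theta e (Finsupp.single i q)
      = ((alpha e ^ i : (AddMonoid.End (ℕ → A))ˣ) : AddMonoid.End (ℕ → A)) (beta e q) :=
  Finsupp.liftAddHom_apply_single _ i q

theorem shiftHom_single (n i : ℤ) (q : A) :
    (shiftHom A (Multiplicative.ofAdd n) (Multiplicative.ofAdd (Finsupp.single i q))).toAdd
      = Finsupp.single (n + i) q :=
  Finsupp.equivMapDomain_single (Equiv.addLeft n) i q

theorem theta_shiftHom (e : A →+ A) (n : ℤ) (g : ℤ →₀ A) :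
    theta e (shiftHom A (Multiplicative.ofAdd n) (Multiplicative.ofAdd g)).toAdd
      = ((alpha e ^ n : (AddMonoid.End (ℕ → A))ˣ) : AddMonoid.End (ℕ → A)) (theta e g) := by
  induction g using Finsupp.induction_linear with
  | zero => simp
  | add f g hf hg => simp only [ofAdd_add, map_mul, toAdd_mul, map_add, hf, hg]
  | single i q =>
    rw [shiftHom_single, theta_single, theta_single, zpow_add, Units.val_mul,
      AddMonoid.End.coe_mul, Function.comp_apply]

theorem theta_injective (e : A →+ A) : Function.Injective (theta e) := by
  refine (injective_iff_map_eq_zero _).2 fun g hg => ?_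
  -- all indices in the support have absolute value less than `m`
  obtain ⟨m, hm⟩ : ∃ m : ℕ, ∀ i ∈ g.support, i.natAbs < m :=
    ⟨g.support.sup Int.natAbs + 1, fun i hi => Nat.lt_succ_of_le (Finset.le_sup hi)⟩
  have h0 := theta_shiftHom e m g
  set g' := (shiftHom A (Multiplicative.ofAdd (m : ℤ)) (Multiplicative.ofAdd g)).toAdd with hg'
  have hval (i : ℤ) : g' i = g (-m + i) := rfl
  rw [hg, map_zero] at h0
  have hsum : g' = ∑ i ∈ Finset.range (2 * m), Finsupp.single (i : ℤ) (g' i) := by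
    ext k
    rw [Finsupp.finsetSum_apply]
    by_cases hk : -(m : ℤ) + k ∈ g.support
    · have := hm _ hk
      obtain ⟨n, rfl⟩ : ∃ n : ℕ, k = n := ⟨k.toNat, by omega⟩
      rw [Finset.sum_eq_single n]
      · simp
      · intro i _ hi
        exact Finsupp.single_eq_of_ne (by exact_mod_cast hi.symm)
      · intro hn
        exact absurd (Finset.mem_range.2 (by omega)) hn
    · have hz : g' k = 0 := by rw [hval]; exact Finsupp.notMem_support_iff.1 hk
      rw [hz]
      refine (Finset.sum_eq_zero fun i _ => ?_).symm
      by_cases hi : (i : ℤ) = k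
      · rw [hi, hz]; simp
      · exact Finsupp.single_eq_of_ne (Ne.symm hi)
  have hz := eq_zero_of_sum_alpha_pow e (2 * m) (fun i => g' i) <| by
    rw [← h0]
    conv_rhs => rw [hsum]
    rw [map_sum]
    refine Finset.sum_congr rfl fun i _ => ?_
    rw [theta_single, zpow_natCast, Units.val_pow_eq_pow_val]
  ext k
  by_contra hk
  have := hm k (Finsupp.mem_support_iff.2 hk)
  have h := hz (k + m).toNat (by omega)
  rw [hval, show -(m : ℤ) + ((k + m).toNat : ℤ) = k by omega] at h
  exact hk h

/-! ### The action on words -/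

/-- Letterwise addition of an initial segment of the sequence `v` to a word. -/
def addSeq : (ℕ → A) → List A → List A
  | _, [] => []
  | v, x :: l => (v 0 + x) :: addSeq (fun n => v (n + 1)) l

theorem addSeq_zero (l : List A) : addSeq 0 l = l := by
  induction l with
  | nil => rfl
  | cons x l ih => exact congrArg₂ List.cons (zero_add x) ih

theorem addSeq_add (v w : ℕ → A) (l : List A) : addSeq (v + w) l = addSeq v (addSeq w l) := by
  induction l generalizing v w with
  | nil => rfl
  | cons x l ih => exact congrArg₂ List.cons (add_assoc _ _ _) (ih _ _)

theorem eq_zero_of_addSeq_replicate {v : ℕ → A}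
    (h : ∀ n, addSeq v (List.replicate n 0) = List.replicate n 0) : v = 0 := by
  funext n
  induction n generalizing v with
  | zero =>
    have := (List.cons.inj (h 1)).1
    rwa [add_zero] at this
  | succ n ih => exact ih (v := fun k => v (k + 1)) fun k => (List.cons.inj (h (k + 1))).2

/-- Translation of words by sequences, as an action of the additive group of sequences. -/
def translation : Multiplicative (ℕ → A) →* Equiv.Perm (List A) where
  toFun v :=
    { toFun := addSeq v.toAdd
      invFun := addSeq (-v.toAdd)
      left_inv := fun l => by rw [← addSeq_add, neg_add_cancel, addSeq_zero]
      right_inv := fun l => by rw [← addSeq_add, add_neg_cancel, addSeq_zero] }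
  map_one' := Equiv.ext addSeq_zero
  map_mul' v w := Equiv.ext (addSeq_add v.toAdd w.toAdd)

/-- The automaton is linear in the state and the input together. -/
theorem stateFun_addSeq (e : A →+ A) (q q' : A) (v : ℕ → A) (l : List A) :
    (automaton e).stateFun (q + q') (addSeq v l)
      = addSeq (v + stateSeq e q v) ((automaton e).stateFun q' l) := by
  induction l generalizing q q' v with
  | nil => rfl
  | cons x l ih =>
    refine congrArg₂ List.cons ?_ ?_
    · change q + q' + (v 0 + x) = v 0 + q + (q' + x)
      abel
    · have htrans : e (q + q') + (v 0 + x) = (e q + v 0) + (e q' + x) := by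
        rw [map_add]; abel
      have htail : (fun n => (v + stateSeq e q v) (n + 1))
          = (fun n => v (n + 1)) + stateSeq e (e q + v 0) fun n => v (n + 1) :=
        funext fun n => congrArg (v (n + 1) + ·) (stateSeq_succ e q v n)
      change (automaton e).stateFun (e (q + q') + (v 0 + x)) (addSeq (fun n => v (n + 1)) l) = _
      rw [htrans, ih, ← htail]
      rfl

/-- The permutation of words given by the state `q`. -/
noncomputable def perm (e : A →+ A) (q : A) : Equiv.Perm (List A) :=
  (automaton e).statePerm (isInvertible e) q

theorem perm_eq (e : A →+ A) (q : A) :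
    perm e q = translation (Multiplicative.ofAdd (beta e q)) * perm e 0 := by
  refine Equiv.ext fun l => ?_
  have h := stateFun_addSeq e q 0 0 l
  rwa [add_zero, addSeq_zero, zero_add] at h

theorem perm_zero_mul_translation (e : A →+ A) (v : ℕ → A) :
    perm e 0 * translation (Multiplicative.ofAdd v)
      = translation (Multiplicative.ofAdd ((alpha e : AddMonoid.End (ℕ → A)) v)) * perm e 0 := by
  refine Equiv.ext fun l => ?_
  have h := stateFun_addSeq e 0 0 v l
  rwa [add_zero] at h

theorem perm_zero_zpow_conj (e : A →+ A) (n : ℤ) (v : ℕ → A) :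
    perm e 0 ^ n * translation (Multiplicative.ofAdd v) * (perm e 0 ^ n)⁻¹
      = translation (Multiplicative.ofAdd
          (((alpha e ^ n : (AddMonoid.End (ℕ → A))ˣ) : AddMonoid.End (ℕ → A)) v)) := by
  have h1 (v : ℕ → A) : perm e 0 * translation (Multiplicative.ofAdd v) * (perm e 0)⁻¹
      = translation (Multiplicative.ofAdd ((alpha e : AddMonoid.End (ℕ → A)) v)) :=
    mul_inv_eq_of_eq_mul (perm_zero_mul_translation e v)
  induction n generalizing v with
  | zero => simp
  | succ n ih =>
    rw [zpow_add_one, zpow_add_one, Units.val_mul, AddMonoid.End.coe_mul, Function.comp_apply,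
      ← ih, ← h1]
    group
  | pred n ih =>
    have h2 : translation (Multiplicative.ofAdd v) = perm e 0 * translation (Multiplicative.ofAdd
        (((alpha e)⁻¹ : (AddMonoid.End (ℕ → A))ˣ).val v)) * (perm e 0)⁻¹ := by
      rw [h1, ← Function.comp_apply (f := ((alpha e : AddMonoid.End (ℕ → A)) : (ℕ → A) → ℕ → A)),
        ← AddMonoid.End.coe_mul, Units.mul_inv, AddMonoid.End.one_apply]
    rw [zpow_sub_one, zpow_sub_one, Units.val_mul, AddMonoid.End.coe_mul, Function.comp_apply,
      ← ih, h2]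
    group

theorem perm_zero_zpow_replicate (e : A →+ A) (n : ℤ) (k : ℕ) :
    (perm e 0 ^ n) (List.replicate k 0) = List.replicate k 0 := by
  have h : perm e 0 (List.replicate k 0) = List.replicate k 0 := by
    induction k with
    | zero => rfl
    | succ k ih =>
      refine congrArg₂ List.cons (zero_add 0) (Eq.trans ?_ ih)
      change (automaton e).stateFun (e 0 + 0) _ = (automaton e).stateFun 0 _
      rw [map_zero, zero_add]
  exact Function.IsFixedPt.perm_zpow h n

/-! ### The isomorphism with the lamplighter group -/

/-- The action of `A ≀ ℤ` on words: `ℤ` acts through the state `0` and a lamp configuration `g`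
translates by `θ g`. -/
noncomputable def lampHom (e : A →+ A) : Lamplighter A →* Equiv.Perm (List A) :=
  SemidirectProduct.lift (translation.comp (theta e).toMultiplicative)
    (zpowersHom _ (perm e 0)) fun n => by
      refine MonoidHom.ext fun g => ?_
      change translation (Multiplicative.ofAdd (theta e (shiftHom A n g).toAdd))
        = perm e 0 ^ n.toAdd * translation (Multiplicative.ofAdd (theta e g.toAdd))
          * (perm e 0 ^ n.toAdd)⁻¹
      rw [perm_zero_zpow_conj, ← theta_shiftHom]
      rfl

theorem lampHom_apply (e : A →+ A) (x : Lamplighter A) :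
    lampHom e x = translation (Multiplicative.ofAdd (theta e x.left.toAdd))
      * perm e 0 ^ x.right.toAdd := rfl

theorem eq_zero_of_addSeq_theta_replicate (e : A →+ A) {g : ℤ →₀ A}
    (h : ∀ k, addSeq (theta e g) (List.replicate k 0) = List.replicate k 0) : g = 0 :=
  (injective_iff_map_eq_zero _).1 (theta_injective e) g (eq_zero_of_addSeq_replicate h)

theorem lampHom_injective [Nontrivial A] (e : A →+ A) : Function.Injective (lampHom e) := by
  refine (injective_iff_map_eq_one _).2 fun x hx => ?_
  -- the words `0 ⋯ 0` are fixed by the state `0`, so they detect the translation part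
  have hl : x.left = 1 := by
    refine eq_zero_of_addSeq_theta_replicate e (g := x.left.toAdd) fun k => ?_
    have h := congrArg (fun p : Equiv.Perm (List A) => p (List.replicate k 0)) hx
    rw [lampHom_apply, Equiv.Perm.mul_apply, perm_zero_zpow_replicate] at h
    exact h
  have hp : perm e 0 ^ x.right.toAdd = 1 := by
    have h := lampHom_apply e x
    rw [hx, hl, toAdd_one, map_zero, ofAdd_zero, map_one, one_mul] at h
    exact h.symm
  -- conjugation by the `n`-th power of the state `0` moves lamp `0` to lamp `n`; a trivial power
  -- therefore has `n = 0`
  obtain ⟨c, hc⟩ := exists_ne (0 : A)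
  have hr : x.right = 1 := by
    by_contra hne
    have hconj := perm_zero_zpow_conj e x.right.toAdd (theta e (Finsupp.single 0 c))
    rw [hp, one_mul, inv_one, mul_one, ← theta_shiftHom, shiftHom_single, add_zero] at hconj
    have hdiff : Finsupp.single 0 c - Finsupp.single x.right.toAdd c = 0 := by
      refine eq_zero_of_addSeq_theta_replicate e fun k => ?_
      have htr : translation (Multiplicative.ofAdd
          (theta e (Finsupp.single 0 c - Finsupp.single x.right.toAdd c))) = 1 := by
        rw [map_sub, ofAdd_sub, map_div, hconj, div_self']
      exact congrArg (fun p : Equiv.Perm (List A) => p (List.replicate k 0)) htr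
    have h0 := DFunLike.congr_fun (sub_eq_zero.1 hdiff) 0
    rw [Finsupp.single_eq_same, Finsupp.single_eq_of_ne] at h0
    · exact hc h0
    · exact fun h => hne (Multiplicative.toAdd.injective h.symm)
  exact SemidirectProduct.ext hl hr

theorem range_lampHom (e : A →+ A) :
    (lampHom e).range = (automaton e).automatonGroup (isInvertible e) := by
  have hmem (q : A) : perm e q ∈ (automaton e).automatonGroup (isInvertible e) :=
    Subgroup.subset_closure ⟨q, rfl⟩
  apply le_antisymm
  · rintro _ ⟨x, rfl⟩
    rw [lampHom_apply]
    refine mul_mem ?_ (zpow_mem (hmem 0) _)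
    induction x.left.toAdd using Finsupp.induction_linear with
    | zero => simp
    | add f g hf hg =>
      rw [map_add, ofAdd_add, map_mul]
      exact mul_mem hf hg
    | single i q =>
      rw [theta_single, ← perm_zero_zpow_conj]
      refine mul_mem (mul_mem (zpow_mem (hmem 0) _) ?_) (inv_mem (zpow_mem (hmem 0) _))
      rw [← mul_inv_eq_of_eq_mul (perm_eq e q)]
      exact mul_mem (hmem q) (inv_mem (hmem 0))
  · refine (Subgroup.closure_le _).2 ?_
    rintro _ ⟨q, rfl⟩
    refine ⟨⟨Multiplicative.ofAdd (Finsupp.single 0 q), Multiplicative.ofAdd 1⟩, ?_⟩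
    rw [lampHom_apply]
    change translation (Multiplicative.ofAdd (theta e (Finsupp.single 0 q))) * perm e 0 ^ (1 : ℤ)
      = perm e q
    rw [theta_single, zpow_zero, zpow_one, perm_eq e q]
    rfl

theorem nonempty_automatonGroup_mulEquiv [Nontrivial A] (e : A →+ A) :
    Nonempty ((automaton e).automatonGroup (isInvertible e) ≃* Lamplighter A) :=
  ⟨((MonoidHom.ofInjective (lampHom_injective e)).trans
    (MulEquiv.subgroupCongr (range_lampHom e))).symm⟩

end AffineAutomaton

theorem mainTheorem4 {A : Type u} [AddCommGroup A] [Finite A] [Nontrivial A]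
    {A₁ : Type v} [AddCommGroup A₁] [Finite A₁] (hA₁ : Odd (Nat.card A₁))
    (t : ℕ) (a : Fin t → ℕ) (ha : ∀ i, a i ≠ 1)
    (hA : Nonempty (A ≃+ A₁ × (∀ i : Fin t, Fin (a i) → ZMod (2 ^ ((i : ℕ) + 1))))) :
    ∃ (Q X : Type u) (_ : Finite Q) (_ : Finite X) (M : MealyAutomaton Q X)
      (hM : M.IsBireversible),
      Nat.card Q = Nat.card A ∧ Nat.card X = Nat.card A ∧
        Nonempty (M.automatonGroup hM.invertible ≃* Lamplighter A) := by
  obtain ⟨f⟩ := hA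
  obtain ⟨e, h0, h1⟩ : HasFixedPointFreeEnd A := .of_addEquiv f <|
    .prod (.of_odd_card hA₁) (.pi fun i => .fin_of_ne_one (ha i))
  exact ⟨A, A, inferInstance, inferInstance, AffineAutomaton.automaton e,
    AffineAutomaton.isBireversible h0 h1, rfl, rfl,
    AffineAutomaton.nonempty_automatonGroup_mulEquiv e⟩
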